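/- A \emph{Moebius system} $(B,T)$ with branches $(J_k)_{k\in I}$ and matrices $\alpha(k)=\begin{pmatrix}a_k&b_k\\c_k&d_k\end{pmatrix}$, $\det\alpha(k)\ne0$, consists of a nonempty interval $B\subseteq\mathbb R$, a countable index set $I$ with $\#I\ge2$, pairwise disjoint intervals $J_k\subseteq B$ that exhaust $B$ up to a Lebesgue null set, and a map $T$ on $B$ such that, for every $k\in I$, $a_k+b_kx\neq 0$ and $Tx=\frac{c_k+d_kx}{a_k+b_kx}$ for $x\in J_k$, and $T$ maps $J_k$ bijectively onto $B$. (The intervals may be open, half-open or closed, bounded or unbounded; the values of $T$ at points of $B$ outside all $J_k$ are immaterial.) A \emph{natural dual} of $(B,T)$ is a Moebius system $(B^*,T^*)$ with branches $(J_k^*)_{k\in I}$, over the same index set, whose matrices are the transposed matrices $\alpha(k)^{\mathsf T}$, that is, $T^*y=\frac{b_k+d_ky}{a_k+c_ky}$ for $y\in J_k^*$. It is \emph{differentiably isomorphic} to $(B,T)$ via $\psi$ if $\psi:B\to B^*$ is a bijection with $\psi(J_k)\subseteq J_k^*$ for all $k\in I$ and $\psi(Tx)=T^*(\psi(x))$ for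 all $x\in\bigcup_k J_k$, and if $\psi'$ exists almost everywhere on $B$ and is not almost everywhere zero. \textbf{Theorem 2.} Let $(B,T)$ be a Moebius system whose map $T$ is conservative with respect to Lebesgue measure on $B$ (that is, $T$ is measurable, preimages of null sets are null, and every measurable $A\subseteq B$ of positive measure contains a point $x$ with $T^nx\in A$ for some $n\ge1$). If a natural dual $(B^*,T^*)$ of $(B,T)$ is differentiably isomorphic to $(B,T)$ via $\psi$, then $\psi$ is a fractional linear map of symmetric form: there are real numbers $a,b,d$ with $ad-b^2\ne0$ such that, for all $t\in B$, $a+bt\neq0$ and $$\psi(t)=\frac{b+dt}{a+bt}.$$ -/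

import Mathlib

open MeasureTheory Set

/-- The fractional linear function `x ↦ (c + d x) / (a + b x)` attached to the matrix
with rows `(a, b)` and `(c, d)`. -/
noncomputable def moebius (m : Matrix (Fin 2) (Fin 2) ℝ) (x : ℝ) : ℝ :=
  (m 1 0 + m 1 1 * x) / (m 0 0 + m 0 1 * x)

/-- `(B, T)` is a Moebius system with branch intervals `J k` and matrices `α k`, `k ∈ I`.
The intervals may be open, half-open or closed, bounded or unbounded.  They exhaust `B` up to a
null set; at the points of `B` outside all `J k` (endpoints of branches, for instance) the value of
`T` is immaterial, and so is everything outside `B`. -/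
structure IsMoebiusSystem {I : Type*} (B : Set ℝ) (T : ℝ → ℝ) (J : I → Set ℝ)
    (α : I → Matrix (Fin 2) (Fin 2) ℝ) : Prop where
  nonempty : B.Nonempty
  ordConnected : B.OrdConnected
  branch_ordConnected : ∀ k, (J k).OrdConnected
  branch_subset : ∀ k, J k ⊆ B
  branch_disjoint : Pairwise fun k l => Disjoint (J k) (J l)
  exhausts : volume (B \ ⋃ k, J k) = 0
  det_ne_zero : ∀ k, (α k).det ≠ 0
  denom_ne_zero : ∀ k, ∀ x ∈ J k, α k 0 0 + α k 0 1 * x ≠ 0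
  eq_moebius : ∀ k, ∀ x ∈ J k, T x = moebius (α k) x
  branch_bijOn : ∀ k, BijOn T (J k) B

/-- `(B', T')`, with branch intervals `J' k`, is a natural dual of the Moebius system with
matrices `α k`: it is a Moebius system with the transposed matrices over the same index set. -/
def IsNaturalDual {I : Type*} (α : I → Matrix (Fin 2) (Fin 2) ℝ) (B' : Set ℝ) (T' : ℝ → ℝ)
    (J' : I → Set ℝ) : Prop :=
  IsMoebiusSystem B' T' J' fun k => (α k).transpose

/-- `ψ` is a differentiable isomorphism from `(B, T)` with branches `J k` to `(B', T')` with
branches `J' k`: a bijection from `B` to `B'` that carries branches to the corresponding branches,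
commutes with the maps, and has almost everywhere a derivative, which is not almost everywhere
zero. -/
structure IsDifferentiableIsomorphism {I : Type*} (B : Set ℝ) (T : ℝ → ℝ) (J : I → Set ℝ)
    (B' : Set ℝ) (T' : ℝ → ℝ) (J' : I → Set ℝ) (ψ : ℝ → ℝ) : Prop where
  bijOn : BijOn ψ B B'
  mapsTo_branch : ∀ k, MapsTo ψ (J k) (J' k)
  commutes : ∀ k, ∀ x ∈ J k, ψ (T x) = T' (ψ x)
  ae_differentiableAt : ∀ᵐ x ∂(volume.restrict B), DifferentiableAt ℝ ψ x
  not_ae_deriv_eq_zero : ¬ ∀ᵐ x ∂(volume.restrict B), deriv ψ x = 0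

/-! ### Fractional linear functions -/

/-! Cross ratios are invariant under fractional linear maps. An inverse branch of `T^[n]` is
fractional linear on all of `B`, and `ψ` turns it into an inverse branch of the dual, again
fractional linear. So the factor by which `ψ` distorts the cross ratio of four points is unchanged
when the points are moved by an inverse branch.

Conservativity provides a nonperiodic point `x₀` with `deriv ψ x₀ ≠ 0` that recurs under every power
of `T`. Along the times at which the orbit is close to `x₀`, the inverse branches following that
orbit contract all interior points to `x₀`: otherwise a neighbourhood of `x₀` would lie in all its
cylinders, and a return to it would make `x₀` periodic (`periodic_of_return`). The contraction has
bounded distortion (`moebius_distortion`), so differentiability at the single point `x₀` makes `ψ`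
asymptotically affine on the contracted points. The distortion factor is therefore 1
(`sameCrossRatio_of_interior`), and `ψ` is fractional linear.

Its matrix `m` satisfies `αᵀ m = ± m α` for every branch matrix `α`. If `m` were not symmetric, `α`
would be scalar or of trace zero, so `T` would be the identity or an involution there and the branch
would fill `B`, leaving no room for a second one. -/

lemma moebius_sub (m : Matrix (Fin 2) (Fin 2) ℝ) {x y : ℝ} (hx : m 0 0 + m 0 1 * x ≠ 0)
    (hy : m 0 0 + m 0 1 * y ≠ 0) :
    moebius m x - moebius m y =
      m.det * (x - y) / ((m 0 0 + m 0 1 * x) * (m 0 0 + m 0 1 * y)) := by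
  rw [Matrix.det_fin_two, moebius, moebius, div_sub_div _ _ hx hy]
  congr 1
  ring

lemma moebius_mul_denom (m n : Matrix (Fin 2) (Fin 2) ℝ) {x : ℝ} (hn : n 0 0 + n 0 1 * x ≠ 0) :
    (m * n) 0 0 + (m * n) 0 1 * x =
      (n 0 0 + n 0 1 * x) * (m 0 0 + m 0 1 * moebius n x) := by
  simp only [Matrix.mul_apply, Fin.sum_univ_two]
  unfold moebius
  field_simp
  ring

lemma moebius_mul (m n : Matrix (Fin 2) (Fin 2) ℝ) {x : ℝ} (hn : n 0 0 + n 0 1 * x ≠ 0) :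
    moebius (m * n) x = moebius m (moebius n x) := by
  have h1 : (m * n) 1 0 + (m * n) 1 1 * x =
      (n 0 0 + n 0 1 * x) * (m 1 0 + m 1 1 * moebius n x) := by
    simp only [Matrix.mul_apply, Fin.sum_univ_two]
    unfold moebius
    field_simp
    ring
  rw [moebius, h1, moebius_mul_denom m n hn, mul_div_mul_left _ _ hn]
  rfl

lemma moebius_adjugate_denom {m : Matrix (Fin 2) (Fin 2) ℝ} (hm : m.det ≠ 0) {x : ℝ}
    (hx : m 0 0 + m 0 1 * x ≠ 0) :
    m.adjugate 0 0 + m.adjugate 0 1 * moebius m x ≠ 0 := by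
  have : m.adjugate 0 0 + m.adjugate 0 1 * moebius m x = m.det / (m 0 0 + m 0 1 * x) := by
    rw [Matrix.adjugate_fin_two, Matrix.det_fin_two]
    simp
    unfold moebius
    field_simp
    ring
  rw [this]
  exact div_ne_zero hm hx

lemma moebius_adjugate {m : Matrix (Fin 2) (Fin 2) ℝ} (hm : m.det ≠ 0) {x : ℝ}
    (hx : m 0 0 + m 0 1 * x ≠ 0) : moebius m.adjugate (moebius m x) = x := by
  rw [← moebius_mul _ _ hx, Matrix.adjugate_mul]
  simp [moebius, hm]

lemma denom_mul_denom_pos {B : Set ℝ} (hB : B.OrdConnected) {a b : ℝ}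
    (h : ∀ x ∈ B, a + b * x ≠ 0) {x y : ℝ} (hx : x ∈ B) (hy : y ∈ B) :
    0 < (a + b * x) * (a + b * y) := by
  by_contra hle
  have hlt : (a + b * x) * (a + b * y) < 0 :=
    lt_of_le_of_ne (not_lt.1 hle) (mul_ne_zero (h x hx) (h y hy))
  have hcont : ContinuousOn (fun z : ℝ => a + b * z) B := by fun_prop
  have himg := (hB.isPreconnected.image _ hcont).ordConnected
  have h0 : (0 : ℝ) ∈ (fun z : ℝ => a + b * z) '' B := by
    rcases mul_neg_iff.1 hlt with ⟨h1, h2⟩ | ⟨h1, h2⟩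
    · exact himg.out (mem_image_of_mem _ hy) (mem_image_of_mem _ hx) ⟨h2.le, h1.le⟩
    · exact himg.out (mem_image_of_mem _ hx) (mem_image_of_mem _ hy) ⟨h1.le, h2.le⟩
  obtain ⟨z, hz, hz0⟩ := h0
  exact h z hz hz0

lemma moebius_sub_eq_pos_mul {B : Set ℝ} (hB : B.OrdConnected) {m : Matrix (Fin 2) (Fin 2) ℝ}
    (h : ∀ x ∈ B, m 0 0 + m 0 1 * x ≠ 0) {x y : ℝ} (hx : x ∈ B) (hy : y ∈ B) :
    ∃ w : ℝ, 0 < w ∧ moebius m x - moebius m y = m.det * w * (x - y) := by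
  refine ⟨_, inv_pos.2 (denom_mul_denom_pos hB h hx hy), ?_⟩
  rw [moebius_sub m (h x hx) (h y hy)]
  ring

/-- The pole `-a / b` is at distance more than `δ` from `t`, whence `|b| * δ ≤ |a + b * t|`. The
bound is uniform in `a` and `b`, hence applies to all inverse branches at once. -/
lemma abs_denom_le {a b t δ : ℝ} (hδ : 0 < δ)
    (h : ∀ x ∈ Icc (t - δ) (t + δ), a + b * x ≠ 0) (q : ℝ) :
    |a + b * q| ≤ (1 + |q - t| / δ) * |a + b * t| := by
  have hb : |b| * δ ≤ |a + b * t| := by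
    by_contra! hlt
    have hb0 : b ≠ 0 := by
      rintro rfl
      simp only [abs_zero, zero_mul] at hlt
      exact absurd hlt (not_lt.2 (abs_nonneg _))
    have hz : |-a / b - t| < δ := by
      have : -a / b - t = -(a + b * t) / b := by field_simp; ring
      rw [this, abs_div, abs_neg, div_lt_iff₀ (abs_pos.2 hb0)]
      linarith [mul_comm |b| δ]
    rw [abs_lt] at hz
    refine h (-a / b) ⟨by linarith, by linarith⟩ ?_
    field_simp
    ring
  calc |a + b * q| = |(a + b * t) + b * (q - t)| := by ring_nf
    _ ≤ |a + b * t| + |b| * |q - t| := by rw [← abs_mul]; exact abs_add_le _ _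
    _ = |a + b * t| + |b| * δ * (|q - t| / δ) := by field_simp
    _ ≤ |a + b * t| + |a + b * t| * (|q - t| / δ) := by gcongr
    _ = _ := by ring

/-- Bounded distortion: a fractional linear function without pole near `t` distorts the distance
ratios of three points, one of which is `t`, by a bounded factor. -/
lemma moebius_distortion {m : Matrix (Fin 2) (Fin 2) ℝ} {t δ x y : ℝ} (hδ : 0 < δ)
    (h : ∀ z ∈ Icc (t - δ) (t + δ), m 0 0 + m 0 1 * z ≠ 0) (hx : m 0 0 + m 0 1 * x ≠ 0)
    (hy : m 0 0 + m 0 1 * y ≠ 0) (hxy : x ≠ y) :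
    |moebius m x - moebius m t| ≤
      |x - t| * (1 + |y - t| / δ) / |x - y| * |moebius m x - moebius m y| := by
  have ht := h t ⟨by linarith, by linarith⟩
  have hb := abs_denom_le hδ h y
  have hxy' : 0 < |x - y| := abs_pos.2 (sub_ne_zero.2 hxy)
  rw [moebius_sub m hx ht, moebius_sub m hx hy]
  simp only [abs_div, abs_mul]
  have hx' := abs_pos.2 hx
  have hy' := abs_pos.2 hy
  have ht' := abs_pos.2 ht
  set X := |m 0 0 + m 0 1 * x|
  set Y := |m 0 0 + m 0 1 * y|
  set Z := |m 0 0 + m 0 1 * t|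
  have e1 : |m.det| * |x - t| / (X * Z) = |m.det| * |x - t| / (X * Z * Y) * Y := by field_simp
  have e2 : |x - t| * (1 + |y - t| / δ) / |x - y| * (|m.det| * |x - y| / (X * Y)) =
      |m.det| * |x - t| / (X * Z * Y) * ((1 + |y - t| / δ) * Z) := by
    field_simp
  rw [e1, e2]
  gcongr

lemma quadratic_eq_zero {S : Set ℝ} (hS : S.Infinite) {q₀ q₁ q₂ : ℝ}
    (h : ∀ x ∈ S, q₀ + q₁ * x + q₂ * x ^ 2 = 0) : q₀ = 0 ∧ q₁ = 0 ∧ q₂ = 0 := by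
  open Polynomial in
  have hp : (C q₀ + C q₁ * X + C q₂ * X ^ 2 : ℝ[X]) = 0 := by
    refine Polynomial.eq_zero_of_infinite_isRoot _ (hS.mono fun x hx => ?_)
    simpa [Polynomial.IsRoot] using h x hx
  refine ⟨?_, ?_, ?_⟩
  · simpa using congrArg (fun p => Polynomial.coeff p 0) hp
  · simpa [Polynomial.coeff_X, Polynomial.coeff_C] using
      congrArg (fun p => Polynomial.coeff p 1) hp
  · simpa [Polynomial.coeff_X, Polynomial.coeff_C] using
      congrArg (fun p => Polynomial.coeff p 2) hp

/-- Equality of the cross ratios of `x₁, …, x₄` and `y₁, …, y₄`. -/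
def SameCrossRatio (x₁ x₂ x₃ x₄ y₁ y₂ y₃ y₄ : ℝ) : Prop :=
  (y₁ - y₂) * (y₃ - y₄) * ((x₁ - x₃) * (x₂ - x₄)) =
    (y₁ - y₃) * (y₂ - y₄) * ((x₁ - x₂) * (x₃ - x₄))

/-- Invariance of the cross ratio without division: each of the four denominators occurs once in
either product, so the factor `c` is common to both. -/
lemma exists_moebius_sub_mul_sub (m : Matrix (Fin 2) (Fin 2) ℝ) (hm : m.det ≠ 0)
    {x₁ x₂ x₃ x₄ : ℝ} (h₁ : m 0 0 + m 0 1 * x₁ ≠ 0) (h₂ : m 0 0 + m 0 1 * x₂ ≠ 0)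
    (h₃ : m 0 0 + m 0 1 * x₃ ≠ 0) (h₄ : m 0 0 + m 0 1 * x₄ ≠ 0) :
    ∃ c : ℝ, c ≠ 0 ∧
      (moebius m x₁ - moebius m x₂) * (moebius m x₃ - moebius m x₄) =
        c * ((x₁ - x₂) * (x₃ - x₄)) ∧
      (moebius m x₁ - moebius m x₃) * (moebius m x₂ - moebius m x₄) =
        c * ((x₁ - x₃) * (x₂ - x₄)) := by
  refine ⟨m.det ^ 2 / ((m 0 0 + m 0 1 * x₁) * (m 0 0 + m 0 1 * x₂) * (m 0 0 + m 0 1 * x₃) *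
    (m 0 0 + m 0 1 * x₄)), by positivity, ?_, ?_⟩
  · rw [moebius_sub m h₁ h₂, moebius_sub m h₃ h₄]
    field_simp
  · rw [moebius_sub m h₁ h₃, moebius_sub m h₂ h₄]
    field_simp

/-! ### Intervals -/

lemma mem_interior_of_lt_of_lt {B : Set ℝ} (hB : B.OrdConnected) {x y z : ℝ} (hx : x ∈ B)
    (hz : z ∈ B) (hxy : x < y) (hyz : y < z) : y ∈ interior B :=
  mem_interior.2 ⟨Ioo x z, fun _ hu => hB.out hx hz ⟨hu.1.le, hu.2.le⟩, isOpen_Ioo, hxy, hyz⟩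

lemma finite_diff_interior {B : Set ℝ} (hB : B.OrdConnected) : (B \ interior B).Finite := by
  have h : B \ interior B ⊆ {x | IsLeast B x} ∪ {x | IsGreatest B x} := by
    rintro x ⟨hx, hxi⟩
    by_contra hcon
    simp only [mem_union, mem_ofPred_eq, not_or, IsLeast, IsGreatest, hx, true_and, lowerBounds,
      upperBounds, not_forall, not_le] at hcon
    obtain ⟨⟨y, hy, hyx⟩, ⟨z, hz, hxz⟩⟩ := hcon
    exact hxi (mem_interior_of_lt_of_lt hB hy hz hyx hxz)
  refine Set.Finite.subset (Set.Finite.union ?_ ?_) h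
  · exact Set.Subsingleton.finite fun x hx y hy => hx.unique hy
  · exact Set.Subsingleton.finite fun x hx y hy => hx.unique hy

/-! ### Cylinders -/

/-- The points of `B` whose first `n` iterates visit the branches prescribed by `k`. -/
def branchCylinder {I : Type*} (B : Set ℝ) (T : ℝ → ℝ) (J : I → Set ℝ) (k : ℕ → I) (n : ℕ) : Set ℝ :=
  {x | x ∈ B ∧ ∀ i < n, T^[i] x ∈ J (k i)}

/-- `moebius v` is the inverse of the `n`-th iterate of `T` on the set `C`, and `ψ` conjugates it
to the inverse of `moebius s`. -/
structure IsInverseBranch (B : Set ℝ) (T ψ : ℝ → ℝ) (C : Set ℝ) (n : ℕ)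
    (v s : Matrix (Fin 2) (Fin 2) ℝ) : Prop where
  det_ne_zero : v.det ≠ 0
  dual_det_ne_zero : s.det ≠ 0
  denom_ne_zero : ∀ p ∈ B, v 0 0 + v 0 1 * p ≠ 0
  mapsTo : ∀ p ∈ B, moebius v p ∈ C
  right_inv : ∀ p ∈ B, T^[n] (moebius v p) = p
  dual_denom_ne_zero : ∀ p ∈ B, s 0 0 + s 0 1 * ψ (moebius v p) ≠ 0
  eq_dual : ∀ p ∈ B, ψ p = moebius s (ψ (moebius v p))
  iterate_mem : ∀ x ∈ C, T^[n] x ∈ B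
  left_inv : ∀ x ∈ C, moebius v (T^[n] x) = x

section

variable {I : Type*} {B : Set ℝ} {T : ℝ → ℝ} {J : I → Set ℝ} {α : I → Matrix (Fin 2) (Fin 2) ℝ}
  {B' : Set ℝ} {T' : ℝ → ℝ} {J' : I → Set ℝ} {ψ : ℝ → ℝ}

lemma IsMoebiusSystem.apply_mul_denom (hT : IsMoebiusSystem B T J α) {k : I} {x : ℝ}
    (hx : x ∈ J k) : T x * (α k 0 0 + α k 0 1 * x) = α k 1 0 + α k 1 1 * x := by
  rw [hT.eq_moebius k x hx, moebius, div_mul_cancel₀ _ (hT.denom_ne_zero k x hx)]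

lemma IsMoebiusSystem.branch_ne [Nontrivial I] (hT : IsMoebiusSystem B T J α) (k : I) :
    ¬ B ⊆ J k := by
  intro h
  obtain ⟨l, hl⟩ := exists_ne k
  obtain ⟨y, hy⟩ := hT.nonempty
  obtain ⟨x, hx, -⟩ := (hT.branch_bijOn l).surjOn hy
  exact (hT.branch_disjoint hl).le_bot ⟨hx, h (hT.branch_subset l hx)⟩

lemma IsMoebiusSystem.branch_unique (hT : IsMoebiusSystem B T J α) {k l : I} {x : ℝ}
    (hk : x ∈ J k) (hl : x ∈ J l) : k = l := by
  by_contra h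
  exact (hT.branch_disjoint h).le_bot ⟨hk, hl⟩

/-- Branches are full, so inverse branches compose on all of `B`. The adjugate serves as inverse,
since scalar factors do not change the map. `v` grows on the right because the newest inverse branch
acts first; `s` grows on the left because the newest dual branch acts last. -/
lemma IsMoebiusSystem.exists_isInverseBranch (hT : IsMoebiusSystem B T J α)
    (hdual : IsNaturalDual α B' T' J') (hψ : IsDifferentiableIsomorphism B T J B' T' J' ψ)
    (k : ℕ → I) (n : ℕ) :
    ∃ v s : Matrix (Fin 2) (Fin 2) ℝ, IsInverseBranch B T ψ (branchCylinder B T J k n) n v s := by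
  induction n with
  | zero =>
    refine ⟨1, 1, ?_⟩
    constructor <;> simp [moebius, branchCylinder]
  | succ n ih =>
    obtain ⟨v, s, h⟩ := ih
    have key : ∀ p ∈ B, ∃ u ∈ J (k n), T u = p ∧
        (α (k n)).adjugate 0 0 + (α (k n)).adjugate 0 1 * p ≠ 0 ∧
        moebius (α (k n)).adjugate p = u := by
      intro p hp
      obtain ⟨u, hu, rfl⟩ := (hT.branch_bijOn (k n)).surjOn hp
      refine ⟨u, hu, rfl, ?_, ?_⟩
      · rw [hT.eq_moebius _ _ hu]
        exact moebius_adjugate_denom (hT.det_ne_zero _) (hT.denom_ne_zero _ _ hu)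
      · rw [hT.eq_moebius _ _ hu]
        exact moebius_adjugate (hT.det_ne_zero _) (hT.denom_ne_zero _ _ hu)
    refine ⟨v * (α (k n)).adjugate, (α (k n)).transpose * s, ?_⟩
    constructor
    · rw [Matrix.det_mul, Matrix.det_adjugate]
      simpa using ⟨h.det_ne_zero, hT.det_ne_zero _⟩
    · rw [Matrix.det_mul, Matrix.det_transpose]
      exact mul_ne_zero (hT.det_ne_zero _) h.dual_det_ne_zero
    · intro p hp
      obtain ⟨u, hu, rfl, hd, he⟩ := key p hp
      rw [moebius_mul_denom _ _ hd, he]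
      exact mul_ne_zero hd (h.denom_ne_zero _ (hT.branch_subset _ hu))
    · intro p hp
      obtain ⟨u, hu, rfl, hd, he⟩ := key p hp
      have huB := hT.branch_subset _ hu
      rw [moebius_mul _ _ hd, he]
      refine ⟨(h.mapsTo u huB).1, fun i hi => ?_⟩
      rcases Nat.lt_succ_iff_lt_or_eq.1 hi with hi | rfl
      · exact (h.mapsTo u huB).2 i hi
      · rwa [h.right_inv u huB]
    · intro p hp
      obtain ⟨u, hu, rfl, hd, he⟩ := key p hp
      rw [moebius_mul _ _ hd, he, Function.iterate_succ_apply',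
        h.right_inv u (hT.branch_subset _ hu)]
    · intro p hp
      obtain ⟨u, hu, rfl, hd, he⟩ := key p hp
      have huB := hT.branch_subset _ hu
      rw [moebius_mul _ _ hd, he, moebius_mul_denom _ _ (h.dual_denom_ne_zero u huB),
        ← h.eq_dual u huB]
      exact mul_ne_zero (h.dual_denom_ne_zero u huB)
        (hdual.denom_ne_zero _ _ (hψ.mapsTo_branch _ hu))
    · intro p hp
      obtain ⟨u, hu, rfl, hd, he⟩ := key p hp
      have huB := hT.branch_subset _ hu
      rw [moebius_mul v _ hd, he, moebius_mul _ _ (h.dual_denom_ne_zero u huB),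
        ← h.eq_dual u huB, hψ.commutes _ _ hu, hdual.eq_moebius _ _ (hψ.mapsTo_branch _ hu)]
    · intro x hx
      rw [Function.iterate_succ_apply']
      exact (hT.branch_bijOn (k n)).mapsTo (hx.2 n n.lt_succ_self)
    · intro x hx
      have hxn : x ∈ branchCylinder B T J k n := ⟨hx.1, fun i hi => hx.2 i (hi.trans n.lt_succ_self)⟩
      have hu := hx.2 n n.lt_succ_self
      obtain ⟨u, hu', hTu, hd, he⟩ := key _ ((hT.branch_bijOn (k n)).mapsTo hu)
      rw [Function.iterate_succ_apply', moebius_mul _ _ hd, he,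
        (hT.branch_bijOn (k n)).injOn hu' hu hTu, h.left_inv x hxn]

lemma branchCylinder_antitone (k : ℕ → I) : Antitone (branchCylinder B T J k) :=
  fun _ _ h _ hx => ⟨hx.1, fun i hi => hx.2 i (hi.trans_le h)⟩

lemma IsInverseBranch.ordConnected {C : Set ℝ} {n : ℕ} {v s : Matrix (Fin 2) (Fin 2) ℝ}
    (h : IsInverseBranch B T ψ C n v s) (hB : B.OrdConnected) : C.OrdConnected := by
  have hC : C = moebius v '' B := by
    ext x
    refine ⟨fun hx => ⟨_, h.iterate_mem x hx, h.left_inv x hx⟩, ?_⟩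
    rintro ⟨p, hp, rfl⟩
    exact h.mapsTo p hp
  rw [hC]
  refine (hB.isPreconnected.image _ ?_).ordConnected
  unfold moebius
  exact ContinuousOn.div (by fun_prop) (by fun_prop) h.denom_ne_zero

lemma IsInverseBranch.sameCrossRatio {C : Set ℝ} {n : ℕ} {v s : Matrix (Fin 2) (Fin 2) ℝ}
    (h : IsInverseBranch B T ψ C n v s) {p₁ p₂ p₃ p₄ : ℝ} (h₁ : p₁ ∈ B) (h₂ : p₂ ∈ B)
    (h₃ : p₃ ∈ B) (h₄ : p₄ ∈ B)
    (hc : SameCrossRatio (moebius v p₁) (moebius v p₂) (moebius v p₃) (moebius v p₄)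
      (ψ (moebius v p₁)) (ψ (moebius v p₂)) (ψ (moebius v p₃)) (ψ (moebius v p₄))) :
    SameCrossRatio p₁ p₂ p₃ p₄ (ψ p₁) (ψ p₂) (ψ p₃) (ψ p₄) := by
  obtain ⟨c, hc0, e1, e2⟩ := exists_moebius_sub_mul_sub v h.det_ne_zero (h.denom_ne_zero _ h₁)
    (h.denom_ne_zero _ h₂) (h.denom_ne_zero _ h₃) (h.denom_ne_zero _ h₄)
  obtain ⟨d, hd0, f1, f2⟩ := exists_moebius_sub_mul_sub s h.dual_det_ne_zero
    (h.dual_denom_ne_zero _ h₁) (h.dual_denom_ne_zero _ h₂) (h.dual_denom_ne_zero _ h₃)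
    (h.dual_denom_ne_zero _ h₄)
  rw [← h.eq_dual _ h₁, ← h.eq_dual _ h₂, ← h.eq_dual _ h₃, ← h.eq_dual _ h₄] at f1 f2
  unfold SameCrossRatio at hc ⊢
  rw [e1, e2] at hc
  rw [f1, f2]
  refine mul_left_cancel₀ hc0 ?_
  linear_combination d * hc

/-! ### Periodic points -/

/-- Such points are roots of the quadratic equation for the fixed points of `moebius v`. Were it to
vanish identically, `moebius v` would be the identity and `B` would lie in one branch. -/
lemma IsMoebiusSystem.finite_fixed [Nontrivial I] (hT : IsMoebiusSystem B T J α)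
    (hdual : IsNaturalDual α B' T' J') (hψ : IsDifferentiableIsomorphism B T J B' T' J' ψ)
    (k : ℕ → I) {n : ℕ} (hn : 0 < n) : {x | x ∈ branchCylinder B T J k n ∧ T^[n] x = x}.Finite := by
  obtain ⟨v, s, h⟩ := hT.exists_isInverseBranch hdual hψ k n
  by_contra hinf
  have hq := quadratic_eq_zero (q₀ := v 1 0) (q₁ := v 1 1 - v 0 0) (q₂ := - v 0 1) hinf
    (by
      rintro x ⟨hx, hfix⟩
      have e := h.left_inv x hx
      rw [hfix, moebius, div_eq_iff (h.denom_ne_zero x hx.1)] at e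
      linear_combination e)
  obtain ⟨h1, h2, h3⟩ := hq
  refine hT.branch_ne (k 0) fun p hp => ?_
  have e : moebius v p = p := by
    rw [moebius, div_eq_iff (h.denom_ne_zero p hp)]
    linear_combination h1 + p * h2 + p ^ 2 * h3
  have := (h.mapsTo p hp).2 0 hn
  rwa [e] at this

lemma IsMoebiusSystem.countable_periodic [Countable I] [Nontrivial I]
    (hT : IsMoebiusSystem B T J α) (hdual : IsNaturalDual α B' T' J')
    (hψ : IsDifferentiableIsomorphism B T J B' T' J' ψ) :
    {x | x ∈ B ∧ (∀ i, ∃ k, T^[i] x ∈ J k) ∧ ∃ n, 0 < n ∧ T^[n] x = x}.Countable := by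
  obtain ⟨k₀, -⟩ := exists_pair_ne I
  -- The padding by `k₀` is irrelevant: only the first `n` letters enter the cylinder.
  let ext : (n : ℕ) → (Fin n → I) → ℕ → I := fun n w i => if h : i < n then w ⟨i, h⟩ else k₀
  have hc : (⋃ n : ℕ, ⋃ w : Fin n → I,
      {x | 0 < n ∧ x ∈ branchCylinder B T J (ext n w) n ∧ T^[n] x = x}).Countable := by
    refine countable_iUnion fun n => countable_iUnion fun w => ?_
    rcases Nat.eq_zero_or_pos n with hn | hn
    · simp [hn]
    · exact (hT.finite_fixed hdual hψ (ext n w) hn).countable.mono fun x hx => hx.2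
  refine hc.mono ?_
  rintro x ⟨hx, hk, n, hn, hfix⟩
  choose k hk using hk
  simp only [mem_iUnion]
  refine ⟨n, fun i => k i, hn, ⟨hx, fun i hi => ?_⟩, hfix⟩
  simp only [ext, hi, dif_pos]
  exact hk i

/-- A recurrent point that comes back to all of its own cylinders is periodic. -/
lemma IsMoebiusSystem.periodic_of_return (hT : IsMoebiusSystem B T J α)
    (hdual : IsNaturalDual α B' T' J') (hψ : IsDifferentiableIsomorphism B T J B' T' J' ψ)
    {x₀ : ℝ} {k : ℕ → I} (hk : ∀ i, T^[i] x₀ ∈ J (k i))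
    (hrec : ∀ N, ∀ s ∈ nhds x₀, ∃ᶠ n in Filter.atTop, (T^[N])^[n] x₀ ∈ s) {N : ℕ}
    (hN : ∀ m, T^[N] x₀ ∈ branchCylinder B T J k m) : T^[N * 2] x₀ = x₀ := by
  obtain ⟨v, s, h⟩ := hT.exists_isInverseBranch hdual hψ k N
  -- Sharing all cylinders with `T^[N] x₀` makes the itinerary of `x₀` periodic, so one inverse
  -- branch `v` governs the whole `T^[N]`-orbit.
  have hper : ∀ i, k (i + N) = k i := fun i => by
    have h1 := (hN (i + 1)).2 i i.lt_succ_self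
    rw [← Function.iterate_add_apply] at h1
    exact hT.branch_unique (hk _) h1
  have hper' : ∀ j i, k (i + N * j) = k i := by
    intro j
    induction j with
    | zero => simp
    | succ j ih =>
      intro i
      rw [Nat.mul_succ, ← add_assoc, hper, ih]
  set z : ℕ → ℝ := fun j => T^[N * j] x₀ with hz
  have hzC : ∀ j, z j ∈ branchCylinder B T J k N := fun j => by
    refine ⟨hT.branch_subset _ (hk _), fun i _ => ?_⟩
    rw [hz, ← Function.iterate_add_apply, ← hper' j i]
    exact hk _
  have hzs : ∀ j, z j = moebius v (z (j + 1)) := fun j => by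
    have : z (j + 1) = T^[N] (z j) := by
      simp only [hz]
      rw [← Function.iterate_add_apply, Nat.mul_succ, add_comm]
    rw [this, h.left_inv _ (hzC j)]
  -- Two applications of `moebius v` preserve order, whatever the sign of `v.det`. Hence the
  -- even-indexed `z` form a monotone sequence, which cannot come back to `x₀` unless `z 2 = x₀`;
  -- this is why the period is `N * 2`.
  have hstep : ∀ j, ∃ w : ℝ, 0 < w ∧ z j - z (j + 2) = w * (z (j + 2) - z (j + 2 + 2)) := by
    intro j
    obtain ⟨w₁, hw₁, e₁⟩ := moebius_sub_eq_pos_mul hT.ordConnected h.denom_ne_zero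
      (hzC (j + 1)).1 (hzC (j + 3)).1
    obtain ⟨w₂, hw₂, e₂⟩ := moebius_sub_eq_pos_mul hT.ordConnected h.denom_ne_zero
      (hzC (j + 2)).1 (hzC (j + 4)).1
    rw [← hzs j, ← hzs (j + 2)] at e₁
    rw [← hzs (j + 1), ← hzs (j + 3)] at e₂
    have := h.det_ne_zero
    refine ⟨v.det ^ 2 * w₁ * w₂, by positivity, ?_⟩
    rw [e₁, e₂]
    ring
  have hz0 : z 0 = x₀ := by simp [hz]
  have hzj : ∀ j, (T^[N * 2])^[j] x₀ = z (2 * j) := fun j => by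
    rw [← Function.iterate_mul, mul_assoc]
  change z 2 = x₀
  rw [← hz0]
  by_contra hne
  rcases lt_or_gt_of_ne hne with hlt | hlt
  · have hmono : ∀ j, z (2 * (j + 1)) < z (2 * j) := by
      intro j
      induction j with
      | zero => simpa using hlt
      | succ j ih =>
        obtain ⟨w, hw, e⟩ := hstep (2 * j)
        have : 0 < w * (z (2 * j + 2) - z (2 * j + 2 + 2)) := by
          rw [← e]; simpa [mul_add] using ih
        have := (pos_iff_pos_of_mul_pos this).1 hw
        simpa [mul_add] using this
    have hanti : StrictAnti fun j => z (2 * j) := strictAnti_nat_of_succ_lt hmono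
    have hfr := hrec (N * 2) (Ioi (z 2)) (Ioi_mem_nhds (hz0 ▸ hlt))
    obtain ⟨j, hj, hm⟩ := Filter.frequently_atTop.1 hfr 1
    rw [hzj] at hm
    exact absurd (hanti.antitone hj) (not_le.2 hm)
  · have hmono : ∀ j, z (2 * j) < z (2 * (j + 1)) := by
      intro j
      induction j with
      | zero => simpa using hlt
      | succ j ih =>
        obtain ⟨w, hw, e⟩ := hstep (2 * j)
        have : 0 < w * (z (2 * j + 2 + 2) - z (2 * j + 2)) := by
          have : z (2 * j) < z (2 * j + 2) := by simpa [mul_add] using ih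
          linarith
        have := (pos_iff_pos_of_mul_pos this).1 hw
        simpa [mul_add] using this
    have hmon : StrictMono fun j => z (2 * j) := strictMono_nat_of_lt_succ hmono
    have hfr := hrec (N * 2) (Iio (z 2)) (Iio_mem_nhds (hz0 ▸ hlt))
    obtain ⟨j, hj, hm⟩ := Filter.frequently_atTop.1 hfr 1
    rw [hzj] at hm
    exact absurd (hmon.monotone hj) (not_le.2 hm)

/-! ### Shrinking cylinders and cross ratios -/

/-- If the inverse branch at the return time `n` does not contract the point `p`, then the cylinder
contains a neighbourhood of `x₀` of controlled size. -/
lemma IsInverseBranch.subset_of_le {C : Set ℝ} {n : ℕ} {v s : Matrix (Fin 2) (Fin 2) ℝ}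
    (h : IsInverseBranch B T ψ C n v s) (hB : B.OrdConnected) {x₀ p δ η ε : ℝ} (hδ : 0 < δ)
    (hη : 0 < η) (hx₀ : x₀ ∈ C)
    (hδB : Icc (x₀ - 2 * δ) (x₀ + 2 * δ) ⊆ B) (hηB : Icc (p - η) (p + η) ⊆ B)
    (hret : T^[n] x₀ ∈ Icc (x₀ - δ) (x₀ + δ)) (hfar : ε ≤ |moebius v p - x₀|) :
    Ioo (x₀ - ε / ((|p - x₀| + δ) * (1 + (|p - x₀| + 2 * δ) / η) / δ))
      (x₀ + ε / ((|p - x₀| + δ) * (1 + (|p - x₀| + 2 * δ) / η) / δ)) ⊆ C := by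
  set K := (|p - x₀| + δ) * (1 + (|p - x₀| + 2 * δ) / η) / δ with hK
  have hKpos : 0 < K := by positivity
  set t := T^[n] x₀ with ht
  have hVt : moebius v t = x₀ := h.left_inv x₀ hx₀
  have htp : |t - p| ≤ |p - x₀| + δ := by
    have h1 : |t - x₀| ≤ δ := abs_le.2 ⟨by linarith [hret.1], by linarith [hret.2]⟩
    calc |t - p| = |(t - x₀) - (p - x₀)| := by ring_nf
      _ ≤ |t - x₀| + |p - x₀| := abs_sub _ _
      _ ≤ _ := by linarith
  have htB : t ∈ B := h.iterate_mem x₀ hx₀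
  -- Distortion centred at `p`: since `moebius v` sends `t` to `x₀` and `p` far from `x₀`, it must
  -- also separate `t` from `t ± δ`. The three factors of `K` bound `|t - p|`, `1 + |y - p| / η` and
  -- `1 / |t - y|`.
  have hbound : ∀ y ∈ B, |t - y| = δ → ε / K ≤ |moebius v y - x₀| := by
    intro y hy hty
    have hne : t ≠ y := by rintro rfl; simp at hty; linarith
    have hd := moebius_distortion hη (fun z hz => h.denom_ne_zero z (hηB hz))
      (h.denom_ne_zero t htB) (h.denom_ne_zero y hy) hne
    rw [hVt, hty] at hd
    have hyp : |y - p| ≤ |p - x₀| + 2 * δ := by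
      calc |y - p| = |(t - p) - (t - y)| := by ring_nf
        _ ≤ |t - p| + |t - y| := abs_sub _ _
        _ ≤ _ := by linarith
    rw [div_le_iff₀' hKpos]
    calc ε ≤ |x₀ - moebius v p| := by rwa [abs_sub_comm]
      _ ≤ _ := hd
      _ ≤ K * |x₀ - moebius v y| := by rw [hK]; gcongr
      _ = K * |moebius v y - x₀| := by rw [abs_sub_comm]
  have hyB : t + δ ∈ B := hδB ⟨by linarith [hret.1], by linarith [hret.2]⟩
  have hyB' : t - δ ∈ B := hδB ⟨by linarith [hret.1], by linarith [hret.2]⟩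
  have h1 := hbound _ hyB (by simp [abs_of_pos hδ])
  have h2 := hbound _ hyB' (by simp [abs_of_pos hδ])
  obtain ⟨w, hw, e⟩ := moebius_sub_eq_pos_mul hB h.denom_ne_zero hyB htB
  obtain ⟨w', hw', e'⟩ := moebius_sub_eq_pos_mul hB h.denom_ne_zero hyB' htB
  rw [hVt] at e e'
  have hC := h.ordConnected hB
  -- The sign of the determinant decides on which side of `x₀` the images of `t + δ` and `t - δ`
  -- lie; the interval between them is in `C`.
  rcases lt_or_gt_of_ne h.det_ne_zero with hdet | hdet
  · have s1 : moebius v (t + δ) - x₀ < 0 := by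
      rw [e]; have := mul_pos (mul_pos (neg_pos.2 hdet) hw) hδ; nlinarith
    have s2 : 0 < moebius v (t - δ) - x₀ := by
      rw [e']; have := mul_pos (mul_pos (neg_pos.2 hdet) hw') hδ; nlinarith
    rw [abs_of_neg s1] at h1
    rw [abs_of_pos s2] at h2
    exact fun x hx => hC.out (h.mapsTo _ hyB) (h.mapsTo _ hyB')
      ⟨by linarith [hx.1], by linarith [hx.2]⟩
  · have s1 : 0 < moebius v (t + δ) - x₀ := by
      rw [e]; have := mul_pos (mul_pos hdet hw) hδ; nlinarith
    have s2 : moebius v (t - δ) - x₀ < 0 := by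
      rw [e']; have := mul_pos (mul_pos hdet hw') hδ; nlinarith
    rw [abs_of_pos s1] at h1
    rw [abs_of_neg s2] at h2
    exact fun x hx => hC.out (h.mapsTo _ hyB') (h.mapsTo _ hyB)
      ⟨by linarith [hx.1], by linarith [hx.2]⟩

/-- The core of the proof: the four points are contracted to `x₀` along its return times, where `ψ`
is asymptotically affine, and invariance brings the limiting equality back to the original points.
-/
lemma IsMoebiusSystem.sameCrossRatio_of_interior (hT : IsMoebiusSystem B T J α)
    (hdual : IsNaturalDual α B' T' J') (hψ : IsDifferentiableIsomorphism B T J B' T' J' ψ)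
    {x₀ : ℝ} (hx₀ : x₀ ∈ interior B) (horb : ∀ i, ∃ k, T^[i] x₀ ∈ J k)
    (hrec : ∀ N, ∀ s ∈ nhds x₀, ∃ᶠ n in Filter.atTop, (T^[N])^[n] x₀ ∈ s)
    (hnp : ∀ n, 0 < n → T^[n] x₀ ≠ x₀) (hdiff : DifferentiableAt ℝ ψ x₀)
    (hderiv : deriv ψ x₀ ≠ 0) {p₁ p₂ p₃ p₄ : ℝ} (h₁ : p₁ ∈ interior B) (h₂ : p₂ ∈ interior B)
    (h₃ : p₃ ∈ interior B) (h₄ : p₄ ∈ interior B) (h₁₂ : p₁ ≠ p₂) (h₁₃ : p₁ ≠ p₃) (h₂₄ : p₂ ≠ p₄)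
    (h₃₄ : p₃ ≠ p₄) : SameCrossRatio p₁ p₂ p₃ p₄ (ψ p₁) (ψ p₂) (ψ p₃) (ψ p₄) := by
  have hball : ∀ p ∈ interior B, ∃ η > 0, Icc (p - η) (p + η) ⊆ B := by
    intro p hp
    obtain ⟨η, hη, hs⟩ := Metric.nhds_basis_closedBall.mem_iff.1 (mem_interior_iff_mem_nhds.1 hp)
    exact ⟨η, hη, by rwa [← Real.closedBall_eq_Icc]⟩
  have hrec1 : ∀ s ∈ nhds x₀, ∃ᶠ n in Filter.atTop, T^[n] x₀ ∈ s := by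
    simpa using hrec 1
  have hx₀B := interior_subset hx₀
  choose k hk using horb
  choose v s h using fun n => hT.exists_isInverseBranch hdual hψ k n
  have hx₀C : ∀ n, x₀ ∈ branchCylinder B T J k n := fun n => ⟨hx₀B, fun i _ => hk i⟩
  obtain ⟨δ', hδ', hδB'⟩ := hball x₀ hx₀
  -- Halving keeps the `δ`-neighbourhood of every return point inside `B`.
  obtain ⟨δ, hδ, rfl⟩ : ∃ δ > 0, δ' = 2 * δ := ⟨δ' / 2, by positivity, by ring⟩
  set S : Set ℕ := {n | T^[n] x₀ ∈ Icc (x₀ - δ) (x₀ + δ)} with hS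
  set F : Filter ℕ := Filter.atTop ⊓ Filter.principal S with hF
  have hne : F.NeBot := Filter.frequently_mem_iff_neBot.1
    (hrec1 _ (Icc_mem_nhds (by linarith) (by linarith)))
  have hshrink : ∀ p ∈ interior B, Filter.Tendsto (fun n => moebius (v n) p) F (nhds x₀) := by
    intro p hp
    obtain ⟨η, hη, hηB⟩ := hball p hp
    rw [Metric.tendsto_nhds]
    intro ε hε
    rw [hF, Filter.eventually_inf_principal]
    by_contra hcon
    rw [Filter.not_eventually] at hcon
    set r := ε / ((|p - x₀| + δ) * (1 + (|p - x₀| + 2 * δ) / η) / δ) with hr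
    have hrpos : 0 < r := by positivity
    have hsub : ∀ m, Ioo (x₀ - r) (x₀ + r) ⊆ branchCylinder B T J k m := by
      intro m
      obtain ⟨n, hmn, hn⟩ := Filter.frequently_atTop.1 hcon m
      rw [Classical.not_imp, Real.dist_eq, not_lt] at hn
      exact ((h n).subset_of_le hT.ordConnected hδ hη (hx₀C n) hδB' hηB hn.1 hn.2).trans
        (branchCylinder_antitone k hmn)
    obtain ⟨N, hN1, hN⟩ := Filter.frequently_atTop.1
      (hrec1 _ (Ioo_mem_nhds (sub_lt_self x₀ hrpos) (lt_add_of_pos_right x₀ hrpos))) 1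
    exact hnp (N * 2) (by omega)
      (hT.periodic_of_return hdual hψ hk hrec fun m => hsub m hN)
  have hden : ∀ n, ∀ p ∈ interior B, v n 0 0 + v n 0 1 * p ≠ 0 :=
    fun n p hp => (h n).denom_ne_zero p (interior_subset hp)
  -- Distortion centred at the return point, which `moebius (v n)` sends to `x₀`: distances to `x₀`
  -- are at most a constant times mutual distances.
  have hbigO : ∀ p ∈ interior B, ∀ q ∈ interior B, p ≠ q →
      (fun n => moebius (v n) p - x₀) =O[F] fun n => moebius (v n) p - moebius (v n) q := by
    intro p hp q hq hpq
    refine Asymptotics.IsBigO.of_bound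
      ((|p - x₀| + δ) * (1 + (|q - x₀| + δ) / δ) / |p - q|) ?_
    rw [hF, Filter.eventually_inf_principal]
    refine Filter.Eventually.of_forall fun n hn => ?_
    have hVt : moebius (v n) (T^[n] x₀) = x₀ := (h n).left_inv x₀ (hx₀C n)
    have hd := moebius_distortion (t := T^[n] x₀) hδ
      (fun z hz => (h n).denom_ne_zero z
        (hδB' ⟨by linarith [hn.1, hz.1], by linarith [hn.2, hz.2]⟩))
      (hden n p hp) (hden n q hq) hpq
    have htri : ∀ y : ℝ, |y - T^[n] x₀| ≤ |y - x₀| + δ := fun y => by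
      have h1 : |T^[n] x₀ - x₀| ≤ δ := abs_le.2 ⟨by linarith [hn.1], by linarith [hn.2]⟩
      calc |y - T^[n] x₀| = |(y - x₀) - (T^[n] x₀ - x₀)| := by ring_nf
        _ ≤ |y - x₀| + |T^[n] x₀ - x₀| := abs_sub _ _
        _ ≤ _ := by linarith
    rw [hVt] at hd
    rw [Real.norm_eq_abs, Real.norm_eq_abs]
    refine hd.trans ?_
    gcongr
    · exact htri p
    · exact htri q
  have hVne : ∀ n, ∀ p ∈ interior B, ∀ q ∈ interior B, p ≠ q →
      moebius (v n) p - moebius (v n) q ≠ 0 := by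
    intro n p hp q hq hpq
    rw [moebius_sub _ (hden n p hp) (hden n q hq)]
    exact div_ne_zero (mul_ne_zero (h n).det_ne_zero (sub_ne_zero.2 hpq))
      (mul_ne_zero (hden n p hp) (hden n q hq))
  -- Neither point need be `x₀`; by `hbigO` the two first-order errors are still negligible against
  -- the distance of the points.
  have hslope : ∀ p ∈ interior B, ∀ q ∈ interior B, p ≠ q →
      Filter.Tendsto (fun n => (ψ (moebius (v n) p) - ψ (moebius (v n) q)) /
        (moebius (v n) p - moebius (v n) q)) F (nhds (deriv ψ x₀)) := by
    intro p hp q hq hpq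
    have ho := hasDerivAt_iff_isLittleO.1 hdiff.hasDerivAt
    have op := (ho.comp_tendsto (hshrink p hp)).trans_isBigO (hbigO p hp q hq hpq)
    have hswap : (fun n => moebius (v n) q - moebius (v n) p) =O[F]
        fun n => moebius (v n) p - moebius (v n) q :=
      Asymptotics.isBigO_of_le F fun n => by rw [norm_sub_rev]
    have oq := (ho.comp_tendsto (hshrink q hq)).trans_isBigO
      ((hbigO q hq p hp hpq.symm).trans hswap)
    have hlim := (op.sub oq).tendsto_div_nhds_zero
    have hlim' := hlim.add_const (deriv ψ x₀)
    rw [zero_add] at hlim'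
    refine hlim'.congr fun n => ?_
    have := hVne n p hp q hq hpq
    simp only [Function.comp, smul_eq_mul]
    field_simp
    ring
  set R : ℝ → ℝ → ℕ → ℝ := fun p q n => (ψ (moebius (v n) p) - ψ (moebius (v n) q)) /
        (moebius (v n) p - moebius (v n) q) with hR
  -- Cross-ratio invariance under `v n` and `s n` leaves only the difference quotients `R`, whose
  -- products both tend to `deriv ψ x₀ ^ 2`.
  have hident : ∀ n, (ψ p₁ - ψ p₂) * (ψ p₃ - ψ p₄) * ((p₁ - p₃) * (p₂ - p₄)) *
      (R p₁ p₃ n * R p₂ p₄ n) =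
      (ψ p₁ - ψ p₃) * (ψ p₂ - ψ p₄) * ((p₁ - p₂) * (p₃ - p₄)) * (R p₁ p₂ n * R p₃ p₄ n) := by
    intro n
    have i₁ := interior_subset h₁
    have i₂ := interior_subset h₂
    have i₃ := interior_subset h₃
    have i₄ := interior_subset h₄
    obtain ⟨c, hc0, e1, e2⟩ := exists_moebius_sub_mul_sub (v n) (h n).det_ne_zero
      (hden n _ h₁) (hden n _ h₂) (hden n _ h₃) (hden n _ h₄)
    obtain ⟨d, hd0, f1, f2⟩ := exists_moebius_sub_mul_sub (s n) (h n).dual_det_ne_zero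
      ((h n).dual_denom_ne_zero _ i₁) ((h n).dual_denom_ne_zero _ i₂)
      ((h n).dual_denom_ne_zero _ i₃) ((h n).dual_denom_ne_zero _ i₄)
    rw [← (h n).eq_dual _ i₁, ← (h n).eq_dual _ i₂, ← (h n).eq_dual _ i₃,
      ← (h n).eq_dual _ i₄] at f1 f2
    have hRe : ∀ p ∈ interior B, ∀ q ∈ interior B, p ≠ q → ψ (moebius (v n) p) -
        ψ (moebius (v n) q) = R p q n * (moebius (v n) p - moebius (v n) q) :=
      fun p hp q hq hpq => (div_mul_cancel₀ _ (hVne n p hp q hq hpq)).symm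
    rw [hRe _ h₁ _ h₂ h₁₂, hRe _ h₃ _ h₄ h₃₄] at f1
    rw [hRe _ h₁ _ h₃ h₁₃, hRe _ h₂ _ h₄ h₂₄] at f2
    rw [f1, f2]
    linear_combination d * R p₁ p₂ n * R p₃ p₄ n * R p₁ p₃ n * R p₂ p₄ n *
      (e1 * ((p₁ - p₃) * (p₂ - p₄)) - e2 * ((p₁ - p₂) * (p₃ - p₄)))
  have hL := ((hslope _ h₁ _ h₃ h₁₃).mul (hslope _ h₂ _ h₄ h₂₄)).const_mul
    ((ψ p₁ - ψ p₂) * (ψ p₃ - ψ p₄) * ((p₁ - p₃) * (p₂ - p₄)))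
  have hRr := ((hslope _ h₁ _ h₂ h₁₂).mul (hslope _ h₃ _ h₄ h₃₄)).const_mul
    ((ψ p₁ - ψ p₃) * (ψ p₂ - ψ p₄) * ((p₁ - p₂) * (p₃ - p₄)))
  have hfin := tendsto_nhds_unique (hL.congr hident) hRr
  exact mul_right_cancel₀ (mul_ne_zero hderiv hderiv) hfin

/-- Every finite configuration in `B` has an inverse branch that moves it into the interior. -/
lemma IsMoebiusSystem.exists_inverseBranch_interior [Nontrivial I]
    (hT : IsMoebiusSystem B T J α) (hdual : IsNaturalDual α B' T' J')
    (hψ : IsDifferentiableIsomorphism B T J B' T' J' ψ) (P : Finset ℝ) (hP : ∀ p ∈ P, p ∈ B) :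
    ∃ (C : Set ℝ) (n : ℕ) (v s : Matrix (Fin 2) (Fin 2) ℝ), IsInverseBranch B T ψ C n v s ∧
      ∀ p ∈ P, moebius v p ∈ interior B := by
  obtain ⟨k, l, hkl⟩ := exists_pair_ne I
  -- The words are `k … k l`, with `l` in position `i`. Their cylinders are disjoint, so the images
  -- of a point are distinct and only finitely many of them can be endpoints of `B`.
  choose v s h using fun i : ℕ =>
    hT.exists_isInverseBranch hdual hψ (fun j => if j = i then l else k) (i + 1)
  have hfin : ∀ p ∈ P, {i | moebius (v i) p ∉ interior B}.Finite := by
    intro p hp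
    have hmem := fun i => (h i).mapsTo p (hP p hp)
    refine Set.Finite.of_finite_image (f := fun i => moebius (v i) p)
      ((finite_diff_interior hT.ordConnected).subset ?_) ?_
    · rintro _ ⟨i, hi, rfl⟩
      exact ⟨(hmem i).1, hi⟩
    · have hlt : ∀ i j, i < j → moebius (v i) p ≠ moebius (v j) p := by
        intro i j hij he
        have h1 := (hmem i).2 i i.lt_succ_self
        have h2 := (hmem j).2 i (by omega)
        simp only [← he, if_neg hij.ne] at h2
        simp only [if_true] at h1
        exact hkl (hT.branch_unique h2 h1)
      intro i _ j _ he
      by_contra hne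
      rcases lt_or_gt_of_ne hne with hij | hij
      · exact hlt i j hij he
      · exact hlt j i hij he.symm
  have hall : (⋃ p ∈ P, {i | moebius (v i) p ∉ interior B}).Finite :=
    P.finite_toSet.biUnion hfin
  obtain ⟨i, hi⟩ := hall.exists_notMem
  refine ⟨_, _, v i, s i, h i, fun p hp => ?_⟩
  by_contra hcon
  exact hi (mem_biUnion hp hcon)

/-! ### Symmetry of the matrix -/

/-- Two invertible matrices of equal determinant that induce the same fractional linear function
are equal up to sign. -/
lemma eq_or_eq_neg_of_wedge_eq_zero {P₀ P₁ P₂ P₃ Q₀ Q₁ Q₂ Q₃ : ℝ}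
    (hdet : P₀ * P₃ - P₁ * P₂ = Q₀ * Q₃ - Q₁ * Q₂) (hQ : Q₀ * Q₃ - Q₁ * Q₂ ≠ 0) {S : Set ℝ}
    (hS : S.Infinite) (h : ∀ x ∈ S, (P₀ + P₁ * x) * (Q₂ + Q₃ * x) =
      (P₂ + P₃ * x) * (Q₀ + Q₁ * x)) :
    (P₀ = Q₀ ∧ P₁ = Q₁ ∧ P₂ = Q₂ ∧ P₃ = Q₃) ∨ (P₀ = -Q₀ ∧ P₁ = -Q₁ ∧ P₂ = -Q₂ ∧ P₃ = -Q₃) := by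
  obtain ⟨q0, q1, q2⟩ := quadratic_eq_zero hS (q₀ := P₀ * Q₂ - P₂ * Q₀)
    (q₁ := P₀ * Q₃ + P₁ * Q₂ - P₂ * Q₁ - P₃ * Q₀) (q₂ := P₁ * Q₃ - P₃ * Q₁)
    (fun x hx => by linear_combination h x hx)
  set D := Q₀ * Q₃ - Q₁ * Q₂ with hD
  -- The vectors `P` and `Q` are proportional with ratio `r / D`; equality of the determinants gives
  -- `r ^ 2 = D ^ 2`.
  set r := Q₃ * P₀ - Q₁ * P₂ with hr
  have e0 : D * P₀ = r * Q₀ := by rw [hD, hr]; linear_combination -Q₁ * q0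
  have e2 : D * P₂ = r * Q₂ := by rw [hD, hr]; linear_combination -Q₃ * q0
  have e1 : D * P₁ = r * Q₁ := by rw [hD, hr]; linear_combination -Q₁ * q1 + Q₀ * q2
  have e3 : D * P₃ = r * Q₃ := by rw [hD, hr]; linear_combination -Q₃ * q1 + Q₂ * q2
  have hr2 : D * D * D = r * r * D := by
    linear_combination (-D * D) * hdet + D * P₃ * e0 + r * Q₀ * e3 - D * P₂ * e1 - r * Q₁ * e2
  rcases mul_self_eq_mul_self_iff.1 (mul_right_cancel₀ hQ hr2) with h | h
  · left
    rw [← h] at e0 e1 e2 e3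
    exact ⟨mul_left_cancel₀ hQ e0, mul_left_cancel₀ hQ e1, mul_left_cancel₀ hQ e2,
      mul_left_cancel₀ hQ e3⟩
  · right
    have h' : r = -D := by rw [h, neg_neg]
    rw [h'] at e0 e1 e2 e3
    refine ⟨mul_left_cancel₀ hQ ?_, mul_left_cancel₀ hQ ?_, mul_left_cancel₀ hQ ?_,
      mul_left_cancel₀ hQ ?_⟩ <;> linarith

/-- If the matrix `m` with rows `(e, f)`, `(g, h)` conjugates the fractional linear function of `α`,
with rows `(a, b)`, `(c, d)`, to that of its transpose and `m` is not symmetric, then `α` is scalar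
or has trace zero. -/
lemma scalar_or_trace_zero {a b c d e f g h : ℝ} (hα : a * d - b * c ≠ 0)
    (hm : e * h - f * g ≠ 0) (hfg : f ≠ g) {S : Set ℝ} (hS : S.Infinite)
    (hx : ∀ x ∈ S, ((a * e + c * g) + (a * f + c * h) * x) * ((g * a + h * c) + (g * b + h * d) * x)
      = ((b * e + d * g) + (b * f + d * h) * x) * ((e * a + f * c) + (e * b + f * d) * x)) :
    (b = 0 ∧ c = 0 ∧ a = d) ∨ a + d = 0 := by
  have hfg' := sub_ne_zero.2 hfg
  have hdet : (e * a + f * c) * (g * b + h * d) - (e * b + f * d) * (g * a + h * c) =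
      (e * h - f * g) * (a * d - b * c) := by ring
  -- The hypothesis compares `αᵀ m` with `m α`, which have the same determinant, so they agree up to
  -- sign.
  rcases eq_or_eq_neg_of_wedge_eq_zero (by ring) (hdet ▸ mul_ne_zero hm hα) hS hx with
    ⟨h0, h1, h2, h3⟩ | ⟨h0, h1, h2, h3⟩
  · left
    have hc : c = 0 := mul_left_cancel₀ hfg' (by linear_combination -h0)
    have hb : b = 0 := mul_left_cancel₀ hfg' (by linear_combination h3)
    refine ⟨hb, hc, sub_eq_zero.1 (mul_left_cancel₀ hfg' ?_)⟩
    rw [hb, hc] at h1 h2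
    linear_combination h1 + h2
  · right
    exact mul_left_cancel₀ hfg' (by linear_combination h1 - h2)

lemma IsMoebiusSystem.branch_infinite (hT : IsMoebiusSystem B T J α) (hB : B.Infinite) (k : I) :
    (J k).Infinite := fun hfin =>
  hB ((hT.branch_bijOn k).image_eq ▸ hfin.image T)

lemma IsMoebiusSystem.not_scalar [Nontrivial I] (hT : IsMoebiusSystem B T J α) (k : I) :
    ¬ (α k 0 1 = 0 ∧ α k 1 0 = 0 ∧ α k 0 0 = α k 1 1) := by
  rintro ⟨hb, hc, had⟩
  refine hT.branch_ne k fun y hy => ?_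
  obtain ⟨x, hx, rfl⟩ := (hT.branch_bijOn k).surjOn hy
  have hd := hT.denom_ne_zero k x hx
  rw [hb, zero_mul, add_zero] at hd
  have : T x = x := by
    have hTx := hT.apply_mul_denom hx
    rw [hb, hc, ← had] at hTx
    exact mul_right_cancel₀ hd (by linear_combination hTx)
  rwa [this]

/-- A fractional linear map of trace zero is an involution. A point `y` of the branch is `T u` with
`u` in the branch, so `T y = u` stays there; but the branch is mapped onto `B`. -/
lemma IsMoebiusSystem.trace_ne_zero [Nontrivial I] (hT : IsMoebiusSystem B T J α) (k : I) :
    α k 0 0 + α k 1 1 ≠ 0 := by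
  intro htr
  have hinv : ∀ x ∈ J k, T x ∈ J k → T (T x) = x := by
    intro x hx hTx
    refine mul_right_cancel₀ (hT.denom_ne_zero k _ hTx) ?_
    linear_combination hT.apply_mul_denom hTx - hT.apply_mul_denom hx + (T x - x) * htr
  have hmaps : ∀ y ∈ J k, T y ∈ J k := by
    intro y hy
    obtain ⟨u, hu, rfl⟩ := (hT.branch_bijOn k).surjOn (hT.branch_subset k hy)
    rwa [hinv u hu hy]
  refine hT.branch_ne k fun y hy => ?_
  obtain ⟨x, hx, rfl⟩ := (hT.branch_bijOn k).surjOn hy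
  exact hmaps x hx

/-- One branch suffices: on it `ψ ∘ T = T' ∘ ψ` says that `αᵀ m` and `m α` induce the same function
at infinitely many points. -/
lemma IsMoebiusSystem.symmetric_of_conjugates [Nontrivial I] (hT : IsMoebiusSystem B T J α)
    (hdual : IsNaturalDual α B' T' J') (hψ : IsDifferentiableIsomorphism B T J B' T' J' ψ)
    (hB : B.Infinite) {e f g h : ℝ} (hm : e * h - f * g ≠ 0)
    (hψm : ∀ x ∈ B, ψ x * (e + f * x) = g + h * x) : f = g := by
  by_contra hfg
  obtain ⟨k, -⟩ := exists_pair_ne I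
  have hdet := hT.det_ne_zero k
  rw [Matrix.det_fin_two] at hdet
  rcases scalar_or_trace_zero hdet hm hfg (hT.branch_infinite hB k) (by
    intro x hx
    have h1 := hψm x (hT.branch_subset k hx)
    have h2 := hψm (T x) ((hT.branch_bijOn k).mapsTo hx)
    have hu := hT.apply_mul_denom hx
    have hw := IsMoebiusSystem.apply_mul_denom hdual (hψ.mapsTo_branch k hx)
    rw [← hψ.commutes k x hx] at hw
    simp only [Matrix.transpose_apply] at hw
    have key : ∀ A C : ℝ, A * e + C * g + (A * f + C * h) * x = (A + C * ψ x) * (e + f * x) := by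
      intro A C
      linear_combination -C * h1
    rw [key, key]
    linear_combination (e + f * x) *
      ((f * (α k 0 1 + α k 1 1 * ψ x) - h * (α k 0 0 + α k 1 0 * ψ x)) * hu -
      (α k 0 0 + α k 1 0 * ψ x) * (α k 0 0 + α k 0 1 * x) * h2 +
      (α k 0 0 + α k 0 1 * x) * (e + f * T x) * hw)) with h | h
  · exact hT.not_scalar k h
  · exact hT.trace_ne_zero k h

/-- A function that preserves cross ratios and is injective is fractional linear. -/
lemma exists_matrix_of_sameCrossRatio (hB : B.Infinite) (hinj : InjOn ψ B)
    (hc : ∀ p₁ ∈ B, ∀ p₂ ∈ B, ∀ p₃ ∈ B, ∀ p₄ ∈ B, p₁ ≠ p₂ → p₁ ≠ p₃ → p₂ ≠ p₄ → p₃ ≠ p₄ →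
      SameCrossRatio p₁ p₂ p₃ p₄ (ψ p₁) (ψ p₂) (ψ p₃) (ψ p₄)) :
    ∃ e f g h : ℝ, e * h - f * g ≠ 0 ∧ ∀ x ∈ B, ψ x * (e + f * x) = g + h * x := by
  obtain ⟨P, hPB, hP⟩ := hB.exists_subset_card_eq 3
  obtain ⟨p₁, p₂, p₃, h₁₂, h₁₃, h₂₃, rfl⟩ := Finset.card_eq_three.1 hP
  have h₁ : p₁ ∈ B := hPB (by simp)
  have h₂ : p₂ ∈ B := hPB (by simp)
  have h₃ : p₃ ∈ B := hPB (by simp)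
  have hsub : ∀ {p q}, p ∈ B → q ∈ B → p ≠ q → ψ p - ψ q ≠ 0 := fun hp hq hpq =>
    sub_ne_zero.2 fun he => hpq (hinj hp hq he)
  set A := (ψ p₁ - ψ p₂) * (p₁ - p₃) with hA
  set D := (ψ p₁ - ψ p₃) * (p₁ - p₂) with hD
  -- The coefficients come from solving the cross-ratio equation for `p₁, p₂, p₃, x`, which is
  -- linear in `ψ x`.
  refine ⟨D * p₃ - A * p₂, A - D, D * ψ p₂ * p₃ - A * ψ p₃ * p₂, A * ψ p₃ - D * ψ p₂, ?_, ?_⟩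
  · have : (D * p₃ - A * p₂) * (A * ψ p₃ - D * ψ p₂) -
        (A - D) * (D * ψ p₂ * p₃ - A * ψ p₃ * p₂) =
        A * D * ((p₂ - p₃) * (ψ p₂ - ψ p₃)) := by ring
    rw [this]
    exact mul_ne_zero (mul_ne_zero
      (mul_ne_zero (hsub h₁ h₂ h₁₂) (sub_ne_zero.2 h₁₃))
      (mul_ne_zero (hsub h₁ h₃ h₁₃) (sub_ne_zero.2 h₁₂)))
      (mul_ne_zero (sub_ne_zero.2 h₂₃) (hsub h₂ h₃ h₂₃))
  · intro x hx
    have hcr : SameCrossRatio p₁ p₂ p₃ x (ψ p₁) (ψ p₂) (ψ p₃) (ψ x) := by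
      by_cases h2 : p₂ = x
      · subst h2; unfold SameCrossRatio; ring
      by_cases h3 : p₃ = x
      · subst h3; unfold SameCrossRatio; ring
      exact hc _ h₁ _ h₂ _ h₃ _ hx h₁₂ h₁₃ h2 h3
    unfold SameCrossRatio at hcr
    rw [hA, hD]
    linear_combination hcr

/-! ### Almost every point is generic -/

lemma ae_mem_interior (hB : B.OrdConnected) : ∀ᵐ x ∂(volume.restrict B), x ∈ interior B := by
  rw [ae_iff, Measure.restrict_apply₀' hB.measurableSet.nullMeasurableSet]
  exact measure_mono_null (t := B \ interior B) (fun x hx => ⟨hx.2, hx.1⟩)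
    ((finite_diff_interior hB).measure_zero volume)

lemma IsMoebiusSystem.ae_orbit (hT : IsMoebiusSystem B T J α)
    (hcons : Conservative T (volume.restrict B)) :
    ∀ᵐ x ∂(volume.restrict B), ∀ i, ∃ k, T^[i] x ∈ J k := by
  have h0 : ∀ᵐ x ∂(volume.restrict B), ∃ k, x ∈ J k := by
    rw [ae_iff, Measure.restrict_apply₀' hT.ordConnected.measurableSet.nullMeasurableSet]
    refine measure_mono_null (t := B \ ⋃ k, J k) (fun x hx => ⟨hx.2, ?_⟩) hT.exhausts
    simpa using hx.1
  exact ae_all_iff.2 fun i => (hcons.toQuasiMeasurePreserving.iterate i).ae h0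

end

theorem theorem2 {I : Type*} [Countable I] [Nontrivial I]
    (B : Set ℝ) (T : ℝ → ℝ) (J : I → Set ℝ) (α : I → Matrix (Fin 2) (Fin 2) ℝ)
    (hT : IsMoebiusSystem B T J α)
    (hcons : Conservative T (volume.restrict B))
    (B' : Set ℝ) (T' : ℝ → ℝ) (J' : I → Set ℝ)
    (hdual : IsNaturalDual α B' T' J')
    (ψ : ℝ → ℝ) (hψ : IsDifferentiableIsomorphism B T J B' T' J' ψ) :
    ∃ a b d : ℝ, a * d - b * b ≠ 0 ∧
      ∀ t ∈ B, a + b * t ≠ 0 ∧ ψ t = (b + d * t) / (a + b * t) := by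
  have hnp : ∀ᵐ x ∂(volume.restrict B),
      ¬ (x ∈ B ∧ (∀ i, ∃ k, T^[i] x ∈ J k) ∧ ∃ n, 0 < n ∧ T^[n] x = x) := by
    rw [ae_iff]
    simp only [not_not]
    exact (hT.countable_periodic hdual hψ).measure_zero _
  have hrec : ∀ᵐ x ∂(volume.restrict B), ∀ N, ∀ s ∈ nhds x,
      ∃ᶠ n in Filter.atTop, (T^[N])^[n] x ∈ s :=
    ae_all_iff.2 fun N => (hcons.iterate N).ae_frequently_mem_of_mem_nhds
  -- The derivative is nonzero on a set that is not null, which therefore meets the conull set of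
  -- generic points.
  obtain ⟨x₀, hderiv, hx₀, horb, hper, hrec, hdiff⟩ :=
    ((Filter.not_eventually.1 hψ.not_ae_deriv_eq_zero).and_eventually
      ((ae_mem_interior hT.ordConnected).and ((hT.ae_orbit hcons).and
        (hnp.and (hrec.and hψ.ae_differentiableAt))))).exists
  have hB : B.Infinite := infinite_of_mem_nhds x₀ (mem_interior_iff_mem_nhds.1 hx₀)
  have hnp : ∀ n, 0 < n → T^[n] x₀ ≠ x₀ := fun n hn he =>
    hper ⟨interior_subset hx₀, horb, n, hn, he⟩
  obtain ⟨e, f, g, h, hm, hψm⟩ := exists_matrix_of_sameCrossRatio hB hψ.bijOn.injOn (by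
    intro p₁ h₁ p₂ h₂ p₃ h₃ p₄ h₄ h₁₂ h₁₃ h₂₄ h₃₄
    obtain ⟨C, n, v, s, hv, hint⟩ := hT.exists_inverseBranch_interior hdual hψ {p₁, p₂, p₃, p₄}
      (by simp [h₁, h₂, h₃, h₄])
    have hne : ∀ {p q}, p ∈ B → q ∈ B → p ≠ q → moebius v p ≠ moebius v q :=
      fun hp hq hpq he => hpq (by rw [← hv.right_inv _ hp, he, hv.right_inv _ hq])
    exact hv.sameCrossRatio h₁ h₂ h₃ h₄ (hT.sameCrossRatio_of_interior hdual hψ hx₀ horb hrec hnp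
      hdiff hderiv (hint _ (by simp)) (hint _ (by simp)) (hint _ (by simp)) (hint _ (by simp))
      (hne h₁ h₂ h₁₂) (hne h₁ h₃ h₁₃) (hne h₂ h₄ h₂₄) (hne h₃ h₄ h₃₄)))
  obtain rfl : f = g := hT.symmetric_of_conjugates hdual hψ hB hm hψm
  refine ⟨e, f, h, hm, fun t ht => ?_⟩
  -- At a zero of the denominator the numerator would vanish too, forcing determinant zero.
  have hne : e + f * t ≠ 0 := by
    intro h0
    have h1 := hψm t ht
    rw [h0, mul_zero] at h1
    have hf : f ≠ 0 := by
      rintro rfl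
      exact hm (by linear_combination h * h0)
    exact hm (mul_left_cancel₀ hf (by linear_combination f * h * h0 + f * f * h1))
  exact ⟨hne, (eq_div_iff hne).2 (hψm t ht)⟩
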